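/- Let $k$ be a field, $\bar k$ an algebraic closure of $k$, $k^{s}$ a separable closure of $k$ (so $k^{s}=\bar k$ if $k$ is perfect), and $G=\mathrm{Gal}(k^{s}/k)$. Let $T$ be an $n$-dimensional algebraic $k$-torus, i.e. an affine algebraic group over $k$, with coordinate ring $A$ (a commutative Hopf $k$-algebra of finite type), such that $T_{\bar k}\cong\mathbb{G}_{m,\bar k}^{\,n}$ as algebraic groups over $\bar k$. Let $K=k^{s}(x_1,\dots,x_n)$. Then $T_{k^{s}}\cong\mathbb{G}_{m,k^{s}}^{\,n}$ as algebraic groups over $k^{s}$. Moreover, let $$\varphi: k^{s}\otimes_k A\;\xrightarrow{\ \sim\ }\;k^{s}[x_1^{\pm1},\dots,x_n^{\pm1}]$$ be the isomorphism of Hopf algebras over $k^{s}$ given by any such isomorphism of algebraic groups. Let $G$ act on $k^{s}\otimes_k A$ by $\sigma(c\otimes a)=\sigma(c)\otimes a$, transport this action along $\varphi$ to $k^{s}[x_1^{\pm1},\dots,x_n^{\pm1}]$, and extend it to the fraction field $K$. Let $K^G$ be the field of invariants. Then: 1. The map $a\mapsto\varphi(1\otimes a)$ extends to an isomorphism over $k$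 from the function field $k(T)=\mathrm{Frac}(A)$ onto $K^G$. 2. $T$ is rational over $k$ (i.e. birational over $k$ to the affine space $\mathbb{A}^m_k$, equivalently to the projective space $\mathbb{P}^m_k$, for some $m\ge 0$) if and only if $K^G$ is $k$-rational (i.e. $K^G\cong k(y_1,\dots,y_m)$ over $k$ for some $m\ge 0$). -/

import Mathlib

open AlgebraicGeometry CategoryTheory
open scoped TensorProduct

universe u

noncomputable section

/-- The field `F(x_1, …, x_n)` of rational functions in `n` variables over `F`. -/
abbrev RationalFunctionField (n : ℕ) (F : Type*) [Field F] : Type _ :=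
  FractionRing (MvPolynomial (Fin n) F)

/-- The coordinate ring `F[x_1^{±1}, …, x_n^{±1}]` of the split torus `𝔾_m^n` over `F`. Its Hopf
algebra structure (Mathlib's on a monoid algebra) makes every monomial `x^m` group-like, which is
the coordinatewise multiplication of `𝔾_m^n`. -/
abbrev SplitTorusRing (n : ℕ) (F : Type*) [Field F] : Type _ :=
  AddMonoidAlgebra F (Fin n → ℤ)

/-- An affine algebraic group over `k` is given by its coordinate ring, a commutative Hopf algebra
`A` of finite type over `k`. It is an `n`-dimensional algebraic `k`-torus if it becomes isomorphic,
as an algebraic group, to `𝔾_m^n` over the algebraic closure of `k`. -/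
structure IsAlgebraicTorus (k : Type*) [Field k] (A : Type*) [CommRing A] [HopfAlgebra k A]
    (n : ℕ) : Prop where
  finiteType : Algebra.FiniteType k A
  exists_splitting :
    Nonempty ((AlgebraicClosure k ⊗[k] A) ≃ₐc[AlgebraicClosure k]
      SplitTorusRing n (AlgebraicClosure k))

/-- The affine `k`-scheme `Spec A` is rational over `k`: it is birational over `k` to an affine
space (equivalently, to a projective space) of some finite dimension over `k`. -/
def IsRationalAffineScheme (k : Type u) [Field k] (A : Type u) [CommRing A] [Algebra k A] : Prop :=
  ∃ m : ℕ, Scheme.BirationalOver (Spec.map (CommRingCat.ofHom (algebraMap k A)))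
    (𝔸(ULift.{u} (Fin m); Spec (CommRingCat.of k)) ↘ Spec (CommRingCat.of k))

/-- The extension `L / k` is `k`-rational: `L` is `k`-isomorphic to `k(x_1, …, x_m)` for
some `m`. -/
def IsRationalFieldExtension (k L : Type*) [Field k] [Field L] [Algebra k L] : Prop :=
  ∃ m : ℕ, Nonempty (L ≃ₐ[k] RationalFunctionField m k)

section LaurentPolynomials

variable (n : ℕ) (F : Type*) [Field F]

/-- The variable `x_i` in `F(x_1, …, x_n)`. -/
def ratVar (i : Fin n) : RationalFunctionField n F :=
  algebraMap (MvPolynomial (Fin n) F) (RationalFunctionField n F) (MvPolynomial.X i)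

theorem ratVar_ne_zero (i : Fin n) : ratVar n F i ≠ 0 := by
  unfold ratVar
  rw [Ne, FaithfulSMul.algebraMap_eq_zero_iff]
  exact MvPolynomial.X_ne_zero i

/-- The monomial `∏ x_i ^ m_i` in `F(x_1, …, x_n)`, for integer exponents. -/
def ratMonomial : Multiplicative (Fin n → ℤ) →* RationalFunctionField n F where
  toFun m := ∏ i, ratVar n F i ^ (m.toAdd i)
  map_one' := by simp
  map_mul' a b := by
    simp [zpow_add₀ (ratVar_ne_zero n F _), Finset.prod_mul_distrib]

/-- The inclusion of Laurent polynomials into rational functions. -/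
def laurentToRat : SplitTorusRing n F →ₐ[F] RationalFunctionField n F :=
  AddMonoidAlgebra.lift F (RationalFunctionField n F) (Fin n → ℤ) (ratMonomial n F)

instance instAlgebraLaurentRat : Algebra (SplitTorusRing n F) (RationalFunctionField n F) :=
  (laurentToRat n F).toAlgebra

theorem algebraMap_laurentRat (f : SplitTorusRing n F) :
    algebraMap (SplitTorusRing n F) (RationalFunctionField n F) f = laurentToRat n F f := rfl

/-- The inclusion of polynomials into Laurent polynomials. -/
def polyToLaurent : MvPolynomial (Fin n) F →ₐ[F] SplitTorusRing n F :=
  MvPolynomial.aeval fun i => AddMonoidAlgebra.single (Pi.single i 1) 1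

theorem laurentToRat_polyToLaurent (p : MvPolynomial (Fin n) F) :
    laurentToRat n F (polyToLaurent n F p) =
      algebraMap (MvPolynomial (Fin n) F) (RationalFunctionField n F) p := by
  have h : (laurentToRat n F).comp (polyToLaurent n F) =
      IsScalarTower.toAlgHom F (MvPolynomial (Fin n) F) (RationalFunctionField n F) := by
    apply MvPolynomial.algHom_ext
    intro i
    simp only [AlgHom.comp_apply, polyToLaurent, MvPolynomial.aeval_X, laurentToRat,
      AddMonoidAlgebra.lift_single, IsScalarTower.toAlgHom_apply, one_smul]
    change ∏ j, ratVar n F j ^ ((Pi.single i 1 : Fin n → ℤ) j) = ratVar n F i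
    rw [Finset.prod_eq_single i] <;> simp +contextual
  exact DFunLike.congr_fun h p

theorem polyToLaurent_prod (m : Fin n → ℕ) :
    polyToLaurent n F (∏ i, MvPolynomial.X i ^ m i) =
      AddMonoidAlgebra.single (fun i => (m i : ℤ)) 1 := by
  simp only [map_prod, map_pow, polyToLaurent, MvPolynomial.aeval_X, AddMonoidAlgebra.single_pow,
    one_pow]
  have h := map_prod (AddMonoidAlgebra.of F (Fin n → ℤ))
    (fun i => Multiplicative.ofAdd (m i • (Pi.single i 1 : Fin n → ℤ))) Finset.univ
  simp only [AddMonoidAlgebra.of_apply, toAdd_ofAdd] at h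
  rw [← h, toAdd_prod]
  congr 1
  ext j
  simp [Finset.sum_apply, Pi.single_apply]

/-- Every Laurent polynomial becomes a polynomial after multiplication with a monomial. -/
theorem exists_polyToLaurent_eq (f : SplitTorusRing n F) :
    ∃ (m : Fin n → ℕ) (p : MvPolynomial (Fin n) F),
      AddMonoidAlgebra.single (fun i => (m i : ℤ)) 1 * f = polyToLaurent n F p := by
  induction f using AddMonoidAlgebra.induction_linear with
  | zero => exact ⟨0, 0, by simp⟩
  | add f g hf hg =>
    obtain ⟨a, p, hp⟩ := hf
    obtain ⟨b, q, hq⟩ := hg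
    refine ⟨a + b, (∏ i, MvPolynomial.X i ^ b i) * p + (∏ i, MvPolynomial.X i ^ a i) * q, ?_⟩
    rw [map_add, map_mul, map_mul, polyToLaurent_prod, polyToLaurent_prod, ← hp, ← hq,
      ← mul_assoc, ← mul_assoc, AddMonoidAlgebra.single_mul_single,
      AddMonoidAlgebra.single_mul_single, mul_one, mul_add]
    congr 3 <;> ext i <;> simp [add_comm]
  | single e c =>
    refine ⟨fun i => (-e i).toNat, MvPolynomial.C c * ∏ i, MvPolynomial.X i ^ (e i).toNat, ?_⟩
    rw [map_mul, polyToLaurent_prod, ← MvPolynomial.algebraMap_eq, AlgHom.commutes,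
      AddMonoidAlgebra.single_mul_single, one_mul, ← Algebra.smul_def, AddMonoidAlgebra.smul_single]
    congr 1
    · ext i
      simp only [Pi.add_apply]
      omega
    · simp

theorem laurentToRat_injective : Function.Injective (laurentToRat n F) := by
  rw [injective_iff_map_eq_zero]
  intro f hf
  obtain ⟨m, p, hp⟩ := exists_polyToLaurent_eq n F f
  have h := congrArg (laurentToRat n F) hp
  rw [map_mul, hf, mul_zero, laurentToRat_polyToLaurent, eq_comm,
    FaithfulSMul.algebraMap_eq_zero_iff] at h
  rw [h, map_zero] at hp
  have h2 := congrArg (AddMonoidAlgebra.single (fun i => -(m i : ℤ)) (1 : F) * ·) hp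
  simp only [← mul_assoc, AddMonoidAlgebra.single_mul_single, mul_one, mul_zero] at h2
  have h3 : ((fun i => -(m i : ℤ)) + fun i => (m i : ℤ)) = (0 : Fin n → ℤ) := by
    ext i
    simp
  rwa [h3, ← AddMonoidAlgebra.one_def, one_mul] at h2

instance instIsDomainLaurent : IsDomain (SplitTorusRing n F) :=
  (laurentToRat_injective n F).isDomain (laurentToRat n F)

/-- `F(x_1, …, x_n)` is the fraction field of the Laurent polynomial ring. -/
instance instIsFractionRingLaurentRat :
    IsFractionRing (SplitTorusRing n F) (RationalFunctionField n F) where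
  map_units y := by
    rw [isUnit_iff_ne_zero, algebraMap_laurentRat, Ne,
      map_eq_zero_iff _ (laurentToRat_injective n F)]
    exact nonZeroDivisors.ne_zero y.2
  surj z := by
    obtain ⟨p, q, hq, rfl⟩ := IsFractionRing.div_surjective (MvPolynomial (Fin n) F) z
    have hq0 : algebraMap (MvPolynomial (Fin n) F) (RationalFunctionField n F) q ≠ 0 := by
      rw [Ne, FaithfulSMul.algebraMap_eq_zero_iff]
      exact nonZeroDivisors.ne_zero hq
    refine ⟨(polyToLaurent n F p, ⟨polyToLaurent n F q, mem_nonZeroDivisors_of_ne_zero ?_⟩), ?_⟩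
    · intro h
      apply hq0
      rw [← laurentToRat_polyToLaurent, h, map_zero]
    · simp only [algebraMap_laurentRat, laurentToRat_polyToLaurent]
      exact div_mul_cancel₀ _ hq0
  exists_of_eq {a b} h := ⟨1, by simpa using laurentToRat_injective n F h⟩

instance instIsScalarTowerLaurentRat (k : Type*) [Field k] [Algebra k F] :
    IsScalarTower k (SplitTorusRing n F) (RationalFunctionField n F) :=
  IsScalarTower.of_algebraMap_eq fun c => by
    rw [algebraMap_laurentRat, IsScalarTower.algebraMap_apply k F (SplitTorusRing n F),
      AlgHom.commutes, ← IsScalarTower.algebraMap_apply]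

end LaurentPolynomials

section GaloisAction

variable {k : Type*} [Field k] {Ω : Type*} [Field Ω] [Algebra k Ω]
  {A : Type*} [CommRing A] [HopfAlgebra k A] {n : ℕ}

variable (k Ω A) in
/-- The Galois action on the coordinate ring `Ω ⊗ A` of the base change of `Spec A` to `Ω`:
`σ` acts on the coefficients, `σ (c ⊗ a) = σ c ⊗ a`. -/
def galoisActionBaseChange : Gal(Ω/k) →* ((Ω ⊗[k] A) ≃ₐ[k] (Ω ⊗[k] A)) where
  toFun σ := Algebra.TensorProduct.congr σ AlgEquiv.refl
  map_one' := by
    ext x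
    induction x with
    | zero => simp
    | tmul c a => simp
    | add x y hx hy => simp_all
  map_mul' σ τ := by
    ext x
    induction x with
    | zero => simp
    | tmul c a => simp
    | add x y hx hy => simp_all

/-- The Galois action on `Ω(x_1, …, x_n)` twisted through a torus: a splitting `φ` of the torus
`Spec A` over `Ω` identifies the coordinate ring `Ω ⊗ A` with the Laurent polynomial ring; the
Galois action on the former is transported along `φ` and extended to the fraction field. -/
def twistedGaloisAction (φ : (Ω ⊗[k] A) ≃ₐc[Ω] SplitTorusRing n Ω) :
    Gal(Ω/k) →* (RationalFunctionField n Ω ≃ₐ[k] RationalFunctionField n Ω) :=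
  (IsFractionRing.fieldEquivOfAlgEquivHom k (RationalFunctionField n Ω)).comp
    ((AlgEquiv.autCongr ((φ : (Ω ⊗[k] A) ≃ₐ[Ω] SplitTorusRing n Ω).restrictScalars k)).toMonoidHom.comp
      (galoisActionBaseChange k Ω A))

/-- On Laurent polynomials the twisted action is the action on `Ω ⊗ A` transported along `φ`. -/
theorem twistedGaloisAction_laurent (φ : (Ω ⊗[k] A) ≃ₐc[Ω] SplitTorusRing n Ω) (σ : Gal(Ω/k))
    (b : Ω ⊗[k] A) :
    twistedGaloisAction φ σ (laurentToRat n Ω (φ b)) =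
      laurentToRat n Ω (φ (galoisActionBaseChange k Ω A σ b)) := by
  have h := IsFractionRing.fieldEquivOfAlgEquiv_algebraMap k (RationalFunctionField n Ω)
    (RationalFunctionField n Ω)
    (AlgEquiv.autCongr ((φ : (Ω ⊗[k] A) ≃ₐ[Ω] SplitTorusRing n Ω).restrictScalars k)
      (galoisActionBaseChange k Ω A σ)) (φ b)
  have h2 : ((φ : (Ω ⊗[k] A) ≃ₐ[Ω] SplitTorusRing n Ω).restrictScalars k).symm (φ b) = b :=
    ((φ : (Ω ⊗[k] A) ≃ₐ[Ω] SplitTorusRing n Ω).restrictScalars k).symm_apply_apply b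
  rw [AlgEquiv.autCongr_apply, AlgEquiv.trans_apply, AlgEquiv.trans_apply, h2] at h
  exact h

/-- The invariant field `K^G` of `K = Ω(x_1, …, x_n)` under the twisted Galois action. -/
def invariantField (φ : (Ω ⊗[k] A) ≃ₐc[Ω] SplitTorusRing n Ω) :
    IntermediateField k (RationalFunctionField n Ω) :=
  IntermediateField.fixedField (twistedGaloisAction φ).range

end GaloisAction

end

/-! Splitting over $k^s$. Since $\bar k/k^s$ is purely inseparable, it is enough to descend the
characters, i.e. the group-like elements, along a purely inseparable extension $L/F$. A linear form
$f$ on the coalgebra defines a convolution operator over $F$ for which every group-like $g$ is an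
eigenvector with eigenvalue $f(g)$. Some $q$-power of this eigenvalue lies in $F$, so the
corresponding power of the operator has an eigenvector over $F$; as Frobenius is injective, that
vector is already an eigenvector for $f(g)$, which forces $f(g) \in F$
(`baseChangeForm_mem_range_of_isGroupLikeElem`). The descended characters give the splitting
(`exists_bialgEquiv_addMonoidAlgebra`).

Invariants. $k^s \otimes A$ is integral over $A$, so every element of $K$ has a denominator in $A$
(`exists_dvd_one_tmul`). The numerator of an invariant fraction is then invariant, and Galois
descent puts it in $A$. Hence $K^G = \mathrm{Frac}(A)$.

Rationality. For affine integral schemes of finite type, birational equivalence over $k$ is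
$k$-isomorphism of function fields: clearing finitely many denominators yields a common
localization, and conversely a birational map identifies the generic points. -/

/-! ### Group-like elements under purely inseparable extensions -/

section GroupLikeDescent

variable {F L H : Type*} [Field F] [Field L] [Algebra F L] [AddCommGroup H] [Module F H]
  [Coalgebra F H]

/-- The convolution operator `x ↦ ∑ f (x₂) x₁` attached to a linear form `f` on a coalgebra. -/
noncomputable def convOperator (f : H →ₗ[F] F) : Module.End F H :=
  (TensorProduct.rid F H).toLinearMap ∘ₗ f.lTensor H ∘ₗ Coalgebra.comul

/-- This turns a question about the value `f x` into one about an eigenvalue. -/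
theorem convOperator_apply_of_isGroupLikeElem (f : H →ₗ[F] F) {x : H}
    (hx : IsGroupLikeElem F x) : convOperator f x = f x • x := by
  simp [convOperator, hx.comul_eq_tmul_self]

variable (L) in
/-- The extension of scalars of a linear form. -/
noncomputable def baseChangeForm (f : H →ₗ[F] F) : L ⊗[F] H →ₗ[L] L :=
  (TensorProduct.AlgebraTensorModule.rid F L L).toLinearMap ∘ₗ f.baseChange L

omit [Coalgebra F H] in
theorem baseChangeForm_tmul (f : H →ₗ[F] F) (c : L) (x : H) :
    baseChangeForm L f (c ⊗ₜ x) = f x • c := by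
  simp [baseChangeForm]

-- The operator over `L` is thus defined over `F`, so that kernels can be compared over the two
-- fields.
variable (L) in
theorem convOperator_baseChange (f : H →ₗ[F] F) :
    convOperator (baseChangeForm L f) = (convOperator f).baseChange L := by
  ext x
  simp only [TensorProduct.AlgebraTensorModule.curry_apply,
    TensorProduct.curry_apply, LinearMap.coe_restrictScalars, LinearMap.baseChange_tmul,
    convOperator, LinearMap.comp_apply, TensorProduct.comul_tmul, CommSemiring.comul_apply]
  induction Coalgebra.comul (R := F) x with
  | zero => simp
  | add x y hx hy => simp only [TensorProduct.tmul_add, map_add, hx, hy]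
  | tmul x y => simp [baseChangeForm_tmul]

theorem Module.Basis.repr_pow_apply_of_eigenvectors {K V ι : Type*} [Field K] [AddCommGroup V]
    [Module K V] (b : Module.Basis ι K V) (T : Module.End K V) (c : ι → K)
    (hT : ∀ i, T (b i) = c i • b i) (r : ℕ) (v : V) (i : ι) :
    b.repr ((T ^ r) v) i = c i ^ r * b.repr v i := by
  have h1 (v : V) : b.repr (T v) i = c i * b.repr v i := by
    have : (Finsupp.lapply i ∘ₗ b.repr.toLinearMap) ∘ₗ T =
        c i • (Finsupp.lapply i ∘ₗ b.repr.toLinearMap) := by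
      refine b.ext fun j => ?_
      by_cases h : j = i
      · subst h; simp [hT]
      · simp [hT, Finsupp.single_eq_of_ne' h]
    exact DFunLike.congr_fun this v
  induction r with
  | zero => simp
  | succ r ih => rw [pow_succ', Module.End.mul_apply, h1, ih, pow_succ', mul_assoc]

/-- If the base change of a coalgebra along a purely inseparable extension is spanned by group-like
elements, then linear forms over the small field take values there on group-like elements. -/
theorem baseChangeForm_mem_range_of_isGroupLikeElem [IsPurelyInseparable F L] {ι : Type*}
    (b : Module.Basis ι L (L ⊗[F] H)) (hb : ∀ i, IsGroupLikeElem L (b i)) (f : H →ₗ[F] F)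
    {x : L ⊗[F] H} (hx : IsGroupLikeElem L x) :
    baseChangeForm L f x ∈ (algebraMap F L).range := by
  set t := baseChangeForm L f x with ht
  obtain ⟨q, hq⟩ := ExpChar.exists F
  have : ExpChar L q := expChar_of_injective_algebraMap (algebraMap F L).injective q
  obtain ⟨r, a, ha⟩ := IsPurelyInseparable.pow_mem F q t
  -- `a` descends `t ^ q ^ r`, so this difference of operators comes from `F` although `t` itself
  -- need not a priori.
  have hbc (y : L ⊗[F] H) : (((convOperator f) ^ q ^ r - a • (1 : Module.End F H)).baseChange L) y =
      ((convOperator (baseChangeForm L f)) ^ q ^ r) y - t ^ q ^ r • y := by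
    rw [LinearMap.baseChange_sub, LinearMap.baseChange_smul, LinearMap.baseChange_pow,
      convOperator_baseChange, LinearMap.sub_apply, LinearMap.smul_apply, ← ha,
      algebraMap_smul, LinearMap.baseChange_one]
    rfl
  -- Flatness would preserve injectivity, but the base change kills `x`.
  have hninj : ¬ Function.Injective ((convOperator f) ^ q ^ r - a • (1 : Module.End F H)) := by
    intro hinj
    have h1 : Function.Injective (((convOperator f) ^ q ^ r - a • (1 : Module.End F H)).baseChange L) :=
      Module.Flat.lTensor_preserves_injective_linearMap _ hinj
    refine hx.ne_zero (h1 ?_)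
    have h2 := Module.End.HasEigenvector.pow_apply
      (f := convOperator (baseChangeForm L f)) (μ := t) (v := x)
      ⟨Module.End.mem_eigenspace_iff.mpr (convOperator_apply_of_isGroupLikeElem _ hx),
        hx.ne_zero⟩ (q ^ r)
    rw [hbc, h2, sub_self, map_zero]
  obtain ⟨w, hw, hw0⟩ : ∃ w, ((convOperator f) ^ q ^ r - a • (1 : Module.End F H)) w = 0 ∧ w ≠ 0 := by
    rw [injective_iff_map_eq_zero] at hninj
    push Not at hninj
    exact hninj
  have hw1 : (convOperator (baseChangeForm L f) ^ q ^ r) (1 ⊗ₜ w) = t ^ q ^ r • (1 ⊗ₜ w) := by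
    rw [← sub_eq_zero, ← hbc, LinearMap.baseChange_tmul, hw, TensorProduct.tmul_zero]
  have hT := b.repr_pow_apply_of_eigenvectors _ _
    fun i => convOperator_apply_of_isGroupLikeElem (baseChangeForm L f) (hb i)
  -- Where a coordinate of `1 ⊗ w` is nonzero, the eigenvalue of `b i` has the same `q ^ r`-th power
  -- as `t`, hence equals `t` by injectivity of Frobenius.
  have hw2 : convOperator (baseChangeForm L f) (1 ⊗ₜ w) = t • (1 ⊗ₜ w) := by
    refine b.repr.injective (Finsupp.ext fun i => ?_)
    have h1 := hT 1 (1 ⊗ₜ w) i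
    rw [pow_one, pow_one] at h1
    rw [h1, map_smul, Finsupp.smul_apply, smul_eq_mul]
    have h2 := hT (q ^ r) (1 ⊗ₜ w) i
    rw [hw1, map_smul, Finsupp.smul_apply, smul_eq_mul, mul_eq_mul_right_iff] at h2
    rcases h2 with h2 | h2
    · rw [iterateFrobenius_inj L q r (a₁ := baseChangeForm L f (b i)) (a₂ := t)
        (by simpa [iterateFrobenius_def] using h2.symm)]
    · simp [h2]
  -- Normalizing `g w = 1` reads off `t` as `g` of a vector of `H`.
  obtain ⟨g, hg⟩ := Module.Projective.exists_dual_eq_one F hw0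
  have := congrArg (baseChangeForm L g) hw2
  rw [convOperator_baseChange, LinearMap.baseChange_tmul, map_smul, baseChangeForm_tmul,
    baseChangeForm_tmul, hg] at this
  exact ⟨g (convOperator f w), by simpa [Algebra.smul_def] using this⟩

/-- Group-like elements descend along purely inseparable extensions. -/
theorem exists_one_tmul_eq_of_isGroupLikeElem [IsPurelyInseparable F L] {ι : Type*}
    (b : Module.Basis ι L (L ⊗[F] H)) (hb : ∀ i, IsGroupLikeElem L (b i))
    {x : L ⊗[F] H} (hx : IsGroupLikeElem L x) : ∃ y : H, 1 ⊗ₜ y = x := by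
  let h := Module.Free.chooseBasis F H
  -- Coordinates in a basis coming from `H` are base-changed forms, so those of `x` lie in `F`.
  have key (i) : (Algebra.TensorProduct.basis L h).coord i = baseChangeForm L (h.coord i) := by
    refine (Algebra.TensorProduct.basis L h).ext fun j => ?_
    by_cases hij : j = i
    · subst hij; simp [baseChangeForm_tmul]
    · simp [baseChangeForm_tmul, Finsupp.single_eq_of_ne' hij]
  choose g hg using fun i =>
    baseChangeForm_mem_range_of_isGroupLikeElem b hb (h.coord i) hx
  refine ⟨∑ i ∈ ((Algebra.TensorProduct.basis L h).repr x).support, g i • h i, ?_⟩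
  conv_rhs => rw [← (Algebra.TensorProduct.basis L h).linearCombination_repr x]
  rw [TensorProduct.tmul_sum, Finsupp.linearCombination_apply, Finsupp.sum]
  refine Finset.sum_congr rfl fun i _ => ?_
  have h1 := DFunLike.congr_fun (key i) x
  rw [Module.Basis.coord_apply, ← hg] at h1
  rw [h1, Algebra.TensorProduct.basis_apply, TensorProduct.tmul_smul, algebraMap_smul]

theorem TensorProduct.one_tmul_injective (F L V : Type*) [Field F] [Field L] [Algebra F L]
    [AddCommGroup V] [Module F V] : Function.Injective fun v : V => (1 : L) ⊗ₜ[F] v := by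
  have h := Module.Flat.rTensor_preserves_injective_linearMap (M := V) (Algebra.linearMap F L)
    (algebraMap F L).injective
  refine fun v w hvw => (TensorProduct.lid F V).symm.injective (h ?_)
  simpa using hvw

variable (L) in
theorem comul_one_tmul (y : H) :
    Coalgebra.comul (R := L) ((1 : L) ⊗ₜ[F] y) =
      TensorProduct.AlgebraTensorModule.distribBaseChange F L H H
        (1 ⊗ₜ Coalgebra.comul (R := F) y) := by
  rw [TensorProduct.comul_tmul, CommSemiring.comul_apply]
  induction Coalgebra.comul (R := F) y with
  | zero => simp
  | add x y hx hy => simp only [TensorProduct.tmul_add, map_add, hx, hy]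
  | tmul x y => simp

/-- An element is group-like if its base change is. -/
theorem isGroupLikeElem_of_one_tmul {y : H} (hy : IsGroupLikeElem L ((1 : L) ⊗ₜ[F] y)) :
    IsGroupLikeElem F y := by
  refine ⟨(algebraMap F L).injective ?_, ?_⟩
  · simpa [Algebra.smul_def] using hy.counit_eq_one
  · have h := hy.comul_eq_tmul_self
    rw [comul_one_tmul, ← TensorProduct.AlgebraTensorModule.distribBaseChange_tmul,
      EmbeddingLike.apply_eq_iff_eq] at h
    exact TensorProduct.one_tmul_injective F L _ h

end GroupLikeDescent

/-! ### Splitting over a separable closure -/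

/-- If a Hopf algebra becomes isomorphic to the group algebra of `M` over a purely inseparable
extension, then it already is. -/
theorem exists_bialgEquiv_addMonoidAlgebra {F L H M : Type*} [Field F] [Field L] [Algebra F L]
    [IsPurelyInseparable F L] [CommRing H] [Bialgebra F H] [AddCommGroup M]
    (e : (L ⊗[F] H) ≃ₐc[L] AddMonoidAlgebra L M) :
    Nonempty (H ≃ₐc[F] AddMonoidAlgebra F M) := by
  let b₀ : Module.Basis M L (AddMonoidAlgebra L M) :=
    Module.Basis.ofRepr (AddMonoidAlgebra.coeffLinearEquiv L)
  let b := b₀.map (e : (L ⊗[F] H) ≃ₐ[L] AddMonoidAlgebra L M).symm.toLinearEquiv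
  have hb (m : M) : e (b m) = AddMonoidAlgebra.single m 1 :=
    EquivLike.apply_inv_apply (e : (L ⊗[F] H) ≃ₐ[L] AddMonoidAlgebra L M) _
  have hg (m : M) : IsGroupLikeElem L (b m) := by
    rw [← isGroupLikeElem_map_equiv e, hb]
    exact AddMonoidAlgebra.isGroupLikeElem_of m
  choose y hy using fun m => exists_one_tmul_eq_of_isGroupLikeElem b hg (hg m)
  have hinj := TensorProduct.one_tmul_injective F L H
  have hyg (m : M) : IsGroupLikeElem F (y m) :=
    isGroupLikeElem_of_one_tmul (L := L) (by rw [hy]; exact hg m)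
  -- Multiplicativity is checked after the injections `y ↦ 1 ⊗ y` and `e`, where it is that of
  -- monomials.
  let ψ₀ : Multiplicative M →* H :=
    { toFun := fun m => y m.toAdd
      map_one' := by
        refine hinj ?_
        simp only [hy]
        refine EquivLike.injective e ?_
        rw [hb, toAdd_one, ← Algebra.TensorProduct.one_def, map_one]; rfl
      map_mul' := fun m m' => by
        refine hinj ?_
        simp only
        rw [hy, ← one_mul (1 : L), ← Algebra.TensorProduct.tmul_mul_tmul, hy, hy]
        refine EquivLike.injective e ?_
        rw [map_mul e, hb, hb, hb, toAdd_mul, AddMonoidAlgebra.single_mul_single, one_mul] }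
  let ψ : AddMonoidAlgebra F M →ₐc[F] H :=
    .ofAlgHom (AddMonoidAlgebra.lift F H M ψ₀)
      (by ext m; simp [ψ₀, (hyg m).counit_eq_one])
      (by ext m; simp [ψ₀, (hyg m).comul_eq_tmul_self])
  -- Over `L` the map carries the monomial basis to `b`; faithful flatness descends bijectivity.
  have hψ : Function.Bijective ψ := by
    let c := Algebra.TensorProduct.basis L
      (Module.Basis.ofRepr (AddMonoidAlgebra.coeffLinearEquiv F) :
        Module.Basis M F (AddMonoidAlgebra F M))
    let ψ' : AddMonoidAlgebra F M →ₗ[F] H := (ψ : AddMonoidAlgebra F M →ₐ[F] H).toLinearMap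
    have h : ψ'.baseChange L = (c.equiv b (Equiv.refl M)).toLinearMap := by
      refine c.ext fun m => ?_
      have h1 : c m = 1 ⊗ₜ AddMonoidAlgebra.single m 1 := Algebra.TensorProduct.basis_apply ..
      have h2 : ψ' (AddMonoidAlgebra.single m 1) = y m := by simp [ψ', ψ, ψ₀]
      rw [LinearEquiv.coe_coe, Module.Basis.equiv_apply, h1, LinearMap.baseChange_tmul, h2, hy]
      rfl
    have h' : Function.Bijective (ψ'.baseChange L) := by
      rw [h]
      exact (c.equiv b (Equiv.refl M)).bijective
    exact (Module.FaithfullyFlat.lTensor_bijective_iff_bijective F L ψ').mp h'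
  exact ⟨(BialgEquiv.ofBijective ψ hψ).symm⟩

/-- Iterated base change of a bialgebra. -/
noncomputable def bialgebraCancelBaseChange (k Ω L A : Type*) [Field k] [Field Ω] [Field L]
    [Algebra k Ω] [Algebra Ω L] [Algebra k L] [IsScalarTower k Ω L] [CommRing A] [Bialgebra k A] :
    (L ⊗[Ω] (Ω ⊗[k] A)) ≃ₐc[L] (L ⊗[k] A) :=
  .ofAlgEquiv (Algebra.TensorProduct.cancelBaseChange k Ω L L A)
    (by ext; simp [Algebra.smul_def, IsScalarTower.algebraMap_eq k Ω L])
    (by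
      ext a
      simp [← (Coalgebra.Repr.arbitrary k a).eq, TensorProduct.tmul_sum])

/-- An algebraic torus splits over a separable closure. -/
theorem IsAlgebraicTorus.nonempty_splitting_sepClosure {k A : Type*} [Field k] [CommRing A]
    [HopfAlgebra k A] {n : ℕ} (hT : IsAlgebraicTorus k A n) (Ω : Type*) [Field Ω] [Algebra k Ω]
    [IsSepClosure k Ω] : Nonempty ((Ω ⊗[k] A) ≃ₐc[Ω] SplitTorusRing n Ω) := by
  have : Algebra.IsSeparable k Ω := IsSepClosure.separable
  have : IsSepClosed Ω := IsSepClosure.sep_closed k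
  let i : Ω →ₐ[k] AlgebraicClosure k := IsAlgClosed.lift
  let := i.toRingHom.toAlgebra
  have : IsScalarTower k Ω (AlgebraicClosure k) :=
    IsScalarTower.of_algebraMap_eq fun x => (i.commutes x).symm
  -- An algebraic extension of the separably closed field `Ω` is purely inseparable.
  have : Algebra.IsAlgebraic Ω (AlgebraicClosure k) := Algebra.IsAlgebraic.tower_top (K := k) Ω
  obtain ⟨e⟩ := hT.exists_splitting
  exact exists_bialgEquiv_addMonoidAlgebra
    ((bialgebraCancelBaseChange k Ω (AlgebraicClosure k) A).trans e)

/-! ### Denominators and Galois descent -/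

/-- In a domain `Ω ⊗ A` with `Ω / k` algebraic, every nonzero element divides a nonzero element
of `A`. -/
theorem exists_dvd_one_tmul {k Ω A : Type*} [Field k] [Field Ω] [Algebra k Ω]
    [Algebra.IsAlgebraic k Ω] [CommRing A] [Algebra k A] [IsDomain (Ω ⊗[k] A)]
    {c : Ω ⊗[k] A} (hc : c ≠ 0) : ∃ a : A, a ≠ 0 ∧ c ∣ 1 ⊗ₜ a := by
  -- The swap makes `A` the left factor, over which the tensor product is integral.
  let e := Algebra.TensorProduct.comm k Ω A
  have : IsDomain (A ⊗[k] Ω) := e.symm.injective.isDomain e.symm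
  have : Nontrivial A := by
    by_contra h
    rw [not_nontrivial_iff_subsingleton] at h
    exact one_ne_zero (α := A ⊗[k] Ω) (Subsingleton.elim _ _)
  have : Algebra.IsIntegral k Ω := Algebra.IsAlgebraic.isIntegral
  obtain ⟨a, ha, h⟩ := (Algebra.IsIntegral.isIntegral (R := A) (e c)).isAlgebraic.exists_nonzero_dvd
    (mem_nonZeroDivisors_of_ne_zero (e.map_ne_zero_iff.mpr hc))
  refine ⟨a, ha, ?_⟩
  simpa [e] using map_dvd e.symm h

/-- Galois descent for `Ω ⊗ A`: the elements fixed by the Galois group are those of `A`. -/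
theorem exists_one_tmul_eq_of_forall_galois {k Ω A : Type*} [Field k] [Field Ω] [Algebra k Ω]
    [IsGalois k Ω] [CommRing A] [HopfAlgebra k A] {x : Ω ⊗[k] A}
    (hx : ∀ σ : Gal(Ω/k), galoisActionBaseChange k Ω A σ x = x) : ∃ a : A, 1 ⊗ₜ a = x := by
  let h := Module.Free.chooseBasis k A
  let b := Algebra.TensorProduct.basis Ω h
  -- The basis comes from `A` and is fixed, so the Galois group acts on coordinates alone.
  have key (σ : Gal(Ω/k)) (i) (y : Ω ⊗[k] A) :
      b.repr (galoisActionBaseChange k Ω A σ y) i = σ (b.repr y i) := by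
    induction y with
    | zero => simp
    | add x y hx hy => simp only [map_add, Finsupp.add_apply, hx, hy]
    | tmul c a => simp [b, galoisActionBaseChange, Algebra.TensorProduct.basis_repr_tmul]
  have hfix (i) : b.repr x i ∈ (⊥ : IntermediateField k Ω) :=
    (InfiniteGalois.mem_bot_iff_fixed _).mpr fun σ => by rw [← key, hx]
  simp only [IntermediateField.mem_bot] at hfix
  choose g hg using hfix
  refine ⟨∑ i ∈ (b.repr x).support, g i • h i, ?_⟩
  conv_rhs => rw [← b.linearCombination_repr x]
  rw [TensorProduct.tmul_sum, Finsupp.linearCombination_apply, Finsupp.sum]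
  refine Finset.sum_congr rfl fun i _ => ?_
  rw [← hg, Algebra.TensorProduct.basis_apply, TensorProduct.tmul_smul, algebraMap_smul]

/-! ### The invariant field as function field -/

section InvariantField

variable {k A Ω : Type*} [Field k] [CommRing A] [HopfAlgebra k A] [Field Ω] [Algebra k Ω] {n : ℕ}
  (φ : (Ω ⊗[k] A) ≃ₐc[Ω] SplitTorusRing n Ω)

/-- The functions on a torus as rational functions, through a splitting. -/
noncomputable def coordinateRingToRat : A →ₐ[k] RationalFunctionField n Ω :=
  (((laurentToRat n Ω).comp (φ : (Ω ⊗[k] A) →ₐ[Ω] SplitTorusRing n Ω)).restrictScalars k).comp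
    Algebra.TensorProduct.includeRight

theorem coordinateRingToRat_apply (a : A) :
    coordinateRingToRat φ a = laurentToRat n Ω (φ (1 ⊗ₜ a)) := rfl

theorem coordinateRingToRat_injective : Function.Injective (coordinateRingToRat φ) :=
  (laurentToRat_injective n Ω).comp
    ((EquivLike.injective φ).comp (TensorProduct.one_tmul_injective k Ω A))

include φ in
theorem isDomain_of_splitting : IsDomain A :=
  (coordinateRingToRat_injective φ).isDomain (coordinateRingToRat φ)

theorem mem_invariantField_iff (z : RationalFunctionField n Ω) :
    z ∈ invariantField φ ↔ ∀ σ, twistedGaloisAction φ σ z = z := by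
  simp [invariantField, IntermediateField.mem_fixedField_iff]

theorem coordinateRingToRat_mem_invariantField (a : A) :
    coordinateRingToRat φ a ∈ invariantField φ := by
  rw [mem_invariantField_iff]
  intro σ
  rw [coordinateRingToRat_apply, twistedGaloisAction_laurent]
  simp [galoisActionBaseChange]

/-- Once the denominator is in `A`, it is invariant, hence so is the numerator, and Galois descent
applies to the latter. -/
theorem exists_div_eq_of_mem_invariantField [IsGalois k Ω] {z : RationalFunctionField n Ω}
    (hz : z ∈ invariantField φ) :
    ∃ a b : A, b ≠ 0 ∧ z = coordinateRingToRat φ a / coordinateRingToRat φ b := by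
  rw [mem_invariantField_iff] at hz
  have : IsDomain (Ω ⊗[k] A) := (EquivLike.injective φ).isDomain φ
  obtain ⟨p, q, hq, rfl⟩ := IsFractionRing.div_surjective (SplitTorusRing n Ω) z
  obtain ⟨p, rfl⟩ := EquivLike.surjective φ p
  obtain ⟨q, rfl⟩ := EquivLike.surjective φ q
  have hq0 : q ≠ 0 := by
    rintro rfl
    exact nonZeroDivisors.ne_zero hq (map_zero φ)
  obtain ⟨b, hb, d, hd⟩ := exists_dvd_one_tmul hq0
  have hb' : coordinateRingToRat φ b ≠ 0 :=
    (map_ne_zero_iff _ (coordinateRingToRat_injective φ)).mpr hb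
  set z := algebraMap (SplitTorusRing n Ω) (RationalFunctionField n Ω) (φ p) /
    algebraMap (SplitTorusRing n Ω) (RationalFunctionField n Ω) (φ q) with hz'
  -- Since `1 ⊗ b = q * d`, the fraction `p / q` equals `p * d` over `b`.
  have hmul : laurentToRat n Ω (φ (p * d)) = z * coordinateRingToRat φ b := by
    have : laurentToRat n Ω (φ q) ≠ 0 :=
      (map_ne_zero_iff _ (laurentToRat_injective n Ω)).mpr (nonZeroDivisors.ne_zero hq)
    rw [coordinateRingToRat_apply, hd, hz', algebraMap_laurentRat, algebraMap_laurentRat,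
      map_mul φ, map_mul φ, map_mul, map_mul]
    field_simp
  obtain ⟨a, ha⟩ := exists_one_tmul_eq_of_forall_galois (x := p * d) fun σ => by
    refine EquivLike.injective φ (laurentToRat_injective n Ω ?_)
    rw [← twistedGaloisAction_laurent, hmul, map_mul, hz, (mem_invariantField_iff φ _).mp
      (coordinateRingToRat_mem_invariantField φ b)]
  exact ⟨a, b, hb, by rw [eq_div_iff hb', ← hmul, ← ha, coordinateRingToRat_apply]⟩

/-- The invariant field of the twisted Galois action is the function field of the torus. -/
theorem exists_fractionRing_algEquiv_invariantField [IsGalois k Ω] :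
    ∃ e : FractionRing A ≃ₐ[k] invariantField φ, ∀ a : A,
      (e (algebraMap A (FractionRing A) a) : RationalFunctionField n Ω) =
        laurentToRat n Ω (φ (1 ⊗ₜ[k] a)) := by
  have := isDomain_of_splitting φ
  let g : A →ₐ[k] invariantField φ :=
    (coordinateRingToRat φ).codRestrict (invariantField φ).toSubalgebra
      (coordinateRingToRat_mem_invariantField φ)
  have hg : Function.Injective g := fun a b h =>
    coordinateRingToRat_injective φ (congrArg Subtype.val h)
  let G : FractionRing A →ₐ[k] invariantField φ := IsFractionRing.liftAlgHom hg
  have hG (a : A) : G (algebraMap A (FractionRing A) a) = g a := IsFractionRing.lift_algebraMap hg a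
  refine ⟨AlgEquiv.ofBijective G ⟨G.toRingHom.injective, ?_⟩, fun a => congrArg Subtype.val (hG a)⟩
  rintro ⟨z, hz⟩
  obtain ⟨a, b, -, rfl⟩ := exists_div_eq_of_mem_invariantField φ hz
  refine ⟨algebraMap A _ a / algebraMap A _ b, Subtype.ext ?_⟩
  rw [map_div₀, hG, hG]
  rfl

end InvariantField

/-! ### Common localizations inside a fraction field -/

section CommonLocalization

variable {k A B K : Type*} [Field k] [CommRing A] [CommRing B] [Field K] [Algebra k A]
  [Algebra k B] [Algebra k K] [Algebra A K] [Algebra B K] [IsScalarTower k A K]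
  [IsScalarTower k B K]

variable (k A B K) in
/-- A finitely generated subalgebra of the fraction field of `B` lies in some `B[1/s]`. -/
theorem exists_common_denominator [IsDomain B] [IsFractionRing B K] [Algebra.FiniteType k A] :
    ∃ s : B, s ≠ 0 ∧ ∀ x : A, ∃ (m : ℕ) (y : B),
      algebraMap B K s ^ m * algebraMap A K x = algebraMap B K y := by
  classical
  obtain ⟨S, hS⟩ := Algebra.FiniteType.out (R := k) (A := A)
  -- One `s` clears the denominators of all generators; products of generators only need higher
  -- powers of it.
  obtain ⟨s, hs⟩ := IsLocalization.exist_integer_multiples_of_finset (nonZeroDivisors B)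
    (S.image (algebraMap A K))
  refine ⟨s, nonZeroDivisors.ne_zero s.2, fun x => ?_⟩
  have hx : x ∈ Algebra.adjoin k (S : Set A) := hS ▸ Algebra.mem_top
  induction hx using Algebra.adjoin_induction with
  | mem x hx =>
    obtain ⟨y, hy⟩ := hs _ (Finset.mem_image_of_mem _ hx)
    exact ⟨1, y, by rw [pow_one, hy, Algebra.smul_def]⟩
  | algebraMap c =>
    exact ⟨0, algebraMap k B c, by
      rw [pow_zero, one_mul, ← IsScalarTower.algebraMap_apply, ← IsScalarTower.algebraMap_apply]⟩
  | add x y _ _ hx hy =>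
    obtain ⟨m, x', hx⟩ := hx
    obtain ⟨n, y', hy⟩ := hy
    refine ⟨m + n, s ^ n * x' + s ^ m * y', ?_⟩
    simp only [map_add, map_mul, map_pow, ← hx, ← hy]
    ring
  | mul x y _ _ hx hy =>
    obtain ⟨m, x', hx⟩ := hx
    obtain ⟨n, y', hy⟩ := hy
    refine ⟨m + n, x' * y', ?_⟩
    simp only [map_mul, ← hx, ← hy]
    ring

variable (K) in
/-- The localization `A[1/a]` inside the fraction field. -/
noncomputable def awaySubalgebra [IsDomain A] [IsFractionRing A K] (a : A) (ha : a ≠ 0) :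
    Subalgebra A K :=
  Localization.subalgebra.ofField K (Submonoid.powers a)
    (powers_le_nonZeroDivisors_of_noZeroDivisors ha)

theorem mem_awaySubalgebra [IsDomain A] [IsFractionRing A K] {a : A} (ha : a ≠ 0) {x : K} :
    x ∈ awaySubalgebra K a ha ↔
      ∃ (p : A) (m : ℕ), x = algebraMap A K p * (algebraMap A K a ^ m)⁻¹ := by
  change (∃ (p s : A) (_ : s ∈ Submonoid.powers a), _) ↔ _
  constructor
  · rintro ⟨p, _, ⟨m, rfl⟩, h⟩
    exact ⟨p, m, by simpa using h⟩
  · rintro ⟨p, m, h⟩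
    exact ⟨p, a ^ m, ⟨m, rfl⟩, by simpa using h⟩

/-- Up to powers of `t`, inverting `t * u` means inverting `t` and `s`. As `B` lies in `A[1/t]`, the
ring `A[1/(tu)]` contains `B`, `1/s` and `1/t`, and therefore `B[1/(sv)]`. The hypotheses are shaped
so that exchanging `A` and `B` gives the other inclusion. -/
theorem mem_awaySubalgebra_of_mem_awaySubalgebra [IsDomain A] [IsDomain B] [IsFractionRing A K]
    [IsFractionRing B K] {t u : A} {s v : B} (ht : t ≠ 0) (hs : s ≠ 0) (hu : u ≠ 0) (hv : v ≠ 0)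
    (htB : ∀ y : B, ∃ (m : ℕ) (x : A), algebraMap A K t ^ m * algebraMap B K y = algebraMap A K x)
    {M N : ℕ} (htu : algebraMap A K t ^ N * algebraMap B K s = algebraMap A K u)
    (hsv : algebraMap B K s ^ M * algebraMap A K t = algebraMap B K v) {z : K}
    (hz : z ∈ awaySubalgebra K (s * v) (mul_ne_zero hs hv)) :
    z ∈ awaySubalgebra K (t * u) (mul_ne_zero ht hu) := by
  have ht' : algebraMap A K t ≠ 0 := by simpa using ht
  have hu' : algebraMap A K u ≠ 0 := by simpa using hu
  have hs' : algebraMap B K s ≠ 0 := by simpa using hs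
  have mem_t : (algebraMap A K t)⁻¹ ∈ awaySubalgebra K (t * u) (mul_ne_zero ht hu) := by
    rw [mem_awaySubalgebra]
    exact ⟨u, 1, by simp only [map_mul]; field_simp⟩
  have mem_s : (algebraMap B K s)⁻¹ ∈ awaySubalgebra K (t * u) (mul_ne_zero ht hu) := by
    rw [mem_awaySubalgebra]
    -- `t * u = t ^ (N + 1) * s`.
    refine ⟨t ^ (N + 1), 1, ?_⟩
    simp only [map_mul, map_pow, ← htu, pow_succ]
    field_simp
  obtain ⟨y, m, rfl⟩ := (mem_awaySubalgebra (mul_ne_zero hs hv)).mp hz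
  obtain ⟨j, p, hp⟩ := htB y
  have hy : algebraMap B K y = algebraMap A K p * (algebraMap A K t)⁻¹ ^ j := by
    rw [← hp, inv_pow]; field_simp
  have hb : (algebraMap B K (s * v) ^ m)⁻¹ =
      ((algebraMap B K s)⁻¹ ^ (M + 1) * (algebraMap A K t)⁻¹) ^ m := by
    rw [map_mul, ← hsv, ← inv_pow]
    congr 1
    rw [inv_pow, pow_succ]
    field_simp
  rw [hy, hb]
  exact mul_mem (mul_mem (Subalgebra.algebraMap_mem _ p) (pow_mem mem_t j))
    (pow_mem (mul_mem (pow_mem mem_s _) mem_t) m)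

/-- The localization `A[1/a]` agrees with its copy inside the fraction field. -/
noncomputable def awayEquivAwaySubalgebra [IsDomain A] [IsFractionRing A K] (a : A) (ha : a ≠ 0) :
    Localization.Away a ≃ₐ[k] (awaySubalgebra K a ha).restrictScalars k :=
  have : IsLocalization (Submonoid.powers a) (awaySubalgebra K a ha) :=
    Localization.subalgebra.isLocalization_ofField K (Submonoid.powers a) _
  (IsLocalization.algEquiv (Submonoid.powers a) (Localization.Away a)
    (awaySubalgebra K a ha)).restrictScalars k

variable (k A B K) in
/-- Two algebras of finite type with the same fraction field have a common localization. -/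
theorem exists_localizationAway_algEquiv [IsDomain A] [IsDomain B] [IsFractionRing A K]
    [IsFractionRing B K] [Algebra.FiniteType k A] [Algebra.FiniteType k B] :
    ∃ (a : A) (b : B), a ≠ 0 ∧ b ≠ 0 ∧
      Nonempty (Localization.Away a ≃ₐ[k] Localization.Away b) := by
  obtain ⟨s, hs, hsA⟩ := exists_common_denominator k A B K
  obtain ⟨t, ht, htB⟩ := exists_common_denominator k B A K
  obtain ⟨N, u, htu⟩ := htB s
  obtain ⟨M, v, hsv⟩ := hsA t
  have ht' : algebraMap A K t ≠ 0 := by simpa using ht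
  have hs' : algebraMap B K s ≠ 0 := by simpa using hs
  have hu : u ≠ 0 := by
    rintro rfl
    simp [ht', hs'] at htu
  have hv : v ≠ 0 := by
    rintro rfl
    simp [ht', hs'] at hsv
  have h : (awaySubalgebra K (t * u) (mul_ne_zero ht hu)).restrictScalars k =
      (awaySubalgebra K (s * v) (mul_ne_zero hs hv)).restrictScalars k :=
    SetLike.ext fun z =>
      ⟨mem_awaySubalgebra_of_mem_awaySubalgebra hs ht hv hu hsA hsv htu,
        mem_awaySubalgebra_of_mem_awaySubalgebra ht hs hu hv htB htu hsv⟩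
  exact ⟨t * u, s * v, mul_ne_zero ht hu, mul_ne_zero hs hv,
    ⟨(awayEquivAwaySubalgebra _ _).trans
      ((Subalgebra.equivOfEq _ _ h).trans (awayEquivAwaySubalgebra _ _).symm)⟩⟩

end CommonLocalization

/-! ### Birational equivalence and function fields -/

section Birational

variable {k : Type u} [Field k] {A B : Type u} [CommRing A] [CommRing B] [Algebra k A]
  [Algebra k B]

theorem birationalOver_of_isIso {S X Y : Scheme.{u}} (f : X ⟶ Y) [IsIso f] {sX : X ⟶ S}
    {sY : Y ⟶ S} (h : f ≫ sY = sX) : Scheme.BirationalOver sX sY :=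
  f.birationalOver sY sX h

theorem birationalOver_spec_of_algEquiv (e : A ≃ₐ[k] B) :
    Scheme.BirationalOver (Spec.map (CommRingCat.ofHom (algebraMap k A)))
      (Spec.map (CommRingCat.ofHom (algebraMap k B))) := by
  have : IsIso (CommRingCat.ofHom (e.symm : B →+* A)) :=
    e.symm.toRingEquiv.toCommRingCatIso.isIso_hom
  refine birationalOver_of_isIso (Spec.map (CommRingCat.ofHom (e.symm : B →+* A))) ?_
  rw [← Spec.map_comp, ← CommRingCat.ofHom_comp]
  congr 2
  ext x
  simp

/-- The basic open immersion is dominant because localizing a domain at a nonzero element is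
injective. -/
theorem birationalOver_spec_localizationAway [IsDomain A] {a : A} (ha : a ≠ 0) :
    Scheme.BirationalOver (Spec.map (CommRingCat.ofHom (algebraMap k (Localization.Away a))))
      (Spec.map (CommRingCat.ofHom (algebraMap k A))) := by
  let f := Spec.map (CommRingCat.ofHom (algebraMap A (Localization.Away a)))
  have : IsDominant f := ⟨by
    refine (PrimeSpectrum.denseRange_comap_iff_ker_le_nilRadical _).mpr ?_
    change RingHom.ker (algebraMap A (Localization.Away a)) ≤ _
    rw [(RingHom.injective_iff_ker_eq_bot _).mp (IsLocalization.injective _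
      (powers_le_nonZeroDivisors_of_noZeroDivisors ha))]
    exact bot_le⟩
  refine f.birationalOver _ _ ?_
  rw [← Spec.map_comp, ← CommRingCat.ofHom_comp, ← IsScalarTower.algebraMap_eq]

/-- Transporting `A` into `FractionRing B` along `e` gives both rings the same fraction field, so a
common localization links the two spectra. -/
theorem birationalOver_spec_of_fractionRing_algEquiv [IsDomain A] [IsDomain B]
    [Algebra.FiniteType k A] [Algebra.FiniteType k B]
    (e : FractionRing A ≃ₐ[k] FractionRing B) :
    Scheme.BirationalOver (Spec.map (CommRingCat.ofHom (algebraMap k A)))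
      (Spec.map (CommRingCat.ofHom (algebraMap k B))) := by
  let : Algebra A (FractionRing B) :=
    ((e : FractionRing A →+* FractionRing B).comp (algebraMap A (FractionRing A))).toAlgebra
  have : IsScalarTower k A (FractionRing B) := IsScalarTower.of_algebraMap_eq fun x => by
    rw [RingHom.algebraMap_toAlgebra, RingHom.comp_apply, ← IsScalarTower.algebraMap_apply]
    simp
  have : IsFractionRing A (FractionRing B) :=
    IsLocalization.isLocalization_of_algEquiv (nonZeroDivisors A)
      (AlgEquiv.ofRingEquiv (f := e.toRingEquiv) (fun _ => rfl) :
        FractionRing A ≃ₐ[A] FractionRing B)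
  obtain ⟨a, b, ha, hb, ⟨e'⟩⟩ := exists_localizationAway_algEquiv k A B (FractionRing B)
  exact (birationalOver_spec_localizationAway ha).symm.trans
    ((birationalOver_spec_of_algEquiv e').trans (birationalOver_spec_localizationAway hb))

/-- An open immersion of integral schemes over `S` identifies the generic points over `S`. -/
theorem exists_functionField_iso_of_isOpenImmersion {S X Y : Scheme.{u}} [IsIntegral X]
    [IsIntegral Y] (f : X ⟶ Y) [IsOpenImmersion f] {sX : X ⟶ S} {sY : Y ⟶ S} (h : f ≫ sY = sX) :
    ∃ e : Spec X.functionField ≅ Spec Y.functionField,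
      e.hom ≫ Y.fromSpecStalk _ ≫ sY = X.fromSpecStalk _ ≫ sX := by
  have hf := genericPoint_eq_of_isOpenImmersion f
  -- The stalk depends on the point; a variable `y` lets the equality of generic points be
  -- substituted.
  have key : ∀ y, f (genericPoint X) = y → ∃ e : Spec X.functionField ≅ Spec (Y.presheaf.stalk y),
      e.hom ≫ Y.fromSpecStalk _ ≫ sY = X.fromSpecStalk _ ≫ sX := by
    rintro _ rfl
    refine ⟨asIso (Spec.map (f.stalkMap (genericPoint X))), ?_⟩
    rw [asIso_hom, Scheme.SpecMap_stalkMap_fromSpecStalk_assoc, h]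
  exact key _ hf

/-- The dense open source of the birational map embeds openly in both schemes, and its generic point
maps to theirs. -/
theorem exists_functionField_iso_of_birationalOver {S X Y : Scheme.{u}} [IsIntegral X]
    [IsIntegral Y] {sX : X ⟶ S} {sY : Y ⟶ S} (h : Scheme.BirationalOver sX sY) :
    ∃ e : Spec X.functionField ≅ Spec Y.functionField,
      e.hom ≫ Y.fromSpecStalk _ ≫ sY = X.fromSpecStalk _ ≫ sX := by
  obtain ⟨g, hg⟩ := h
  have : Nonempty g.source := g.dense_source.nonempty.to_subtype
  obtain ⟨e₁, h₁⟩ := exists_functionField_iso_of_isOpenImmersion g.source.ι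
    (sX := g.source.ι ≫ sX) rfl
  obtain ⟨e₂, h₂⟩ := exists_functionField_iso_of_isOpenImmersion (g.iso.hom ≫ g.target.ι)
    (sX := g.source.ι ≫ sX) (sY := sY) (by simpa using hg)
  exact ⟨e₁.symm ≪≫ e₂, by rw [Iso.trans_hom, Iso.symm_hom, Category.assoc, h₂, ← h₁,
    Iso.inv_hom_id_assoc]⟩

theorem exists_fromSpecStalk_genericPoint_eq (R : CommRingCat.{u}) [IsDomain R] :
    ∃ e : FractionRing R ≃+* (Spec R).functionField,
      (Spec R).fromSpecStalk (genericPoint (Spec R)) =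
        Spec.map (CommRingCat.ofHom (e.toRingHom.comp (algebraMap R (FractionRing R)))) := by
  let e : FractionRing R ≃ₐ[R] (Spec R).functionField := FractionRing.algEquiv R _
  refine ⟨e.toRingEquiv, (Spec.fromSpecStalk_eq' _ _).trans (congrArg Spec.map ?_)⟩
  ext x
  exact (e.commutes x).symm

/-- Full faithfulness of `Spec` turns the identification of generic points into a ring isomorphism;
compatibility over `Spec k` is its `k`-linearity. -/
theorem nonempty_fractionRing_algEquiv_of_birationalOver_spec [IsDomain A] [IsDomain B]
    (h : Scheme.BirationalOver (Spec.map (CommRingCat.ofHom (algebraMap k A)))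
      (Spec.map (CommRingCat.ofHom (algebraMap k B)))) :
    Nonempty (FractionRing A ≃ₐ[k] FractionRing B) := by
  obtain ⟨e, he⟩ := exists_functionField_iso_of_birationalOver h
  let θ : (Spec (CommRingCat.of B)).functionField ≅ (Spec (CommRingCat.of A)).functionField :=
    { hom := Spec.preimage e.hom
      inv := Spec.preimage e.inv
      hom_inv_id := Spec.map_injective (by simp)
      inv_hom_id := Spec.map_injective (by simp) }
  have hθ : Spec.map θ.hom = e.hom := Spec.map_preimage _
  obtain ⟨eA, hA⟩ := exists_fromSpecStalk_genericPoint_eq (CommRingCat.of A)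
  obtain ⟨eB, hB⟩ := exists_fromSpecStalk_genericPoint_eq (CommRingCat.of B)
  rw [hA, hB, ← hθ, ← Spec.map_comp, ← Spec.map_comp, ← Spec.map_comp, Spec.map_inj] at he
  let r : FractionRing B ≃+* FractionRing A :=
    (eB.trans θ.commRingCatIsoToRingEquiv).trans eA.symm
  have hr (x : k) : r (algebraMap k _ x) = algebraMap k _ x := by
    have h1 : θ.hom (eB (algebraMap B (FractionRing B) (algebraMap k B x))) =
        eA (algebraMap A (FractionRing A) (algebraMap k A x)) := congr($he x)
    rw [IsScalarTower.algebraMap_apply k B (FractionRing B),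
      IsScalarTower.algebraMap_apply k A (FractionRing A)]
    exact (eA.symm_apply_eq).mpr h1
  exact ⟨(AlgEquiv.ofRingEquiv (f := r) hr).symm⟩

/-- A function field criterion for rationality. -/
theorem isRationalAffineScheme_iff [IsDomain A] [Algebra.FiniteType k A] :
    IsRationalAffineScheme k A ↔ IsRationalFieldExtension k (FractionRing A) := by
  -- The same `m` serves both sides, with affine space replaced by the spectrum of a polynomial
  -- ring.
  refine exists_congr fun m => ?_
  let R := MvPolynomial (ULift.{u} (Fin m)) k
  have h : Scheme.BirationalOver (Spec.map (CommRingCat.ofHom (algebraMap k R)))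
      (𝔸(ULift.{u} (Fin m); Spec (CommRingCat.of k)) ↘ Spec (CommRingCat.of k)) :=
    birationalOver_of_isIso (AffineSpace.SpecIso (ULift.{u} (Fin m)) (CommRingCat.of k)).inv
      (AffineSpace.SpecIso_inv_over _)
  let e : FractionRing R ≃ₐ[k] RationalFunctionField m k :=
    IsFractionRing.fieldEquivOfAlgEquiv k _ _ 
      (MvPolynomial.renameEquiv k Equiv.ulift : R ≃ₐ[k] MvPolynomial (Fin m) k)
  constructor
  · intro h'
    obtain ⟨e'⟩ := nonempty_fractionRing_algEquiv_of_birationalOver_spec (h'.trans h.symm)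
    exact ⟨e'.trans e⟩
  · rintro ⟨e'⟩
    exact (birationalOver_spec_of_fractionRing_algEquiv (e'.trans e.symm)).trans h

end Birational

/-! ### The main theorem -/

theorem IsRationalFieldExtension.congr {k L L' : Type*} [Field k] [Field L] [Field L']
    [Algebra k L] [Algebra k L'] (e : L ≃ₐ[k] L') :
    IsRationalFieldExtension k L ↔ IsRationalFieldExtension k L' :=
  exists_congr fun _ => ⟨fun ⟨f⟩ => ⟨e.symm.trans f⟩, fun ⟨f⟩ => ⟨e.trans f⟩⟩

theorem mainTheorem1 (k : Type u) [Field k] (A : Type u) [CommRing A] [HopfAlgebra k A]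
    (n : ℕ) (hT : IsAlgebraicTorus k A n)
    (Ω : Type*) [Field Ω] [Algebra k Ω] [IsSepClosure k Ω] :
    Nonempty ((Ω ⊗[k] A) ≃ₐc[Ω] SplitTorusRing n Ω) ∧
    ∀ φ : (Ω ⊗[k] A) ≃ₐc[Ω] SplitTorusRing n Ω,
      (∃ e : FractionRing A ≃ₐ[k] invariantField φ, ∀ a : A,
        (e (algebraMap A (FractionRing A) a) : RationalFunctionField n Ω) =
          laurentToRat n Ω (φ (1 ⊗ₜ[k] a))) ∧
      (IsRationalAffineScheme k A ↔ IsRationalFieldExtension k (invariantField φ)) := by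
  refine ⟨hT.nonempty_splitting_sepClosure Ω, fun φ => ?_⟩
  have : IsGalois k Ω := IsSepClosure.isGalois
  have := isDomain_of_splitting φ
  have := hT.finiteType
  obtain ⟨e, he⟩ := exists_fractionRing_algEquiv_invariantField φ
  exact ⟨⟨e, he⟩, isRationalAffineScheme_iff.trans (IsRationalFieldExtension.congr e)⟩
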